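/- Let $m\ge 0$ be an integer and $j$ the imaginary unit. Let $\mathcal{RH}_\infty^{m\times m}$ be the set of $m\times m$ matrices of proper real-rational functions of $s$ without poles in the closed right half-plane, and for $G\in\mathcal{RH}_\infty^{m\times m}$ put $G(\pm j\infty):=G(\infty)=\lim_{|s|\to\infty}G(s)$. For nonzero $x,y\in\mathbb{C}^m$ let $$\gamma(x,y)=\frac{\|y\|_2}{\|x\|_2},\qquad \theta(x,y)=\arccos\frac{\mathrm{Re}(x^*y)}{\|x\|_2\|y\|_2}\in[0,\pi],$$ and for $A\in\mathbb{C}^{m\times m}$ define the scaled graph and the inverse scaled graph of $A$ by $$\mathrm{SG}(A)=\{\gamma(x,Ax)e^{\pm j\theta(x,Ax)} : x\in\mathbb{C}^m,\ x\neq 0,\ Ax\ne 0\},$$ $$\mathrm{SG}^\dagger(A)=\{\gamma(Ax,x)e^{\pm j\theta(Ax,x)} : x\in\mathbb{C}^m,\ x\ne 0,\ Ax\neq 0\}.$$ For $P,C\in\mathcal{RH}_\infty^{m\times m}$, the positive feedback system $P\#C$ is called stable ($0$-dominant) if it is well-posed, i.e. the matrix $I-P(\infty)C(\infty)$ has full rank,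 and the closed-loop transfer matrix $$\begin{bmatrix} I & -C\\ -P & I\end{bmatrix}^{-1}$$ is proper, has no poles on the imaginary axis, and has $0$ poles in the open right half-plane. Theorem. Let $P,C\in\mathcal{RH}_\infty^{m\times m}$. If $$\mathrm{SG}(\tau P(j\omega))\cap\mathrm{SG}^\dagger(C(j\omega))=\emptyset\qquad\text{for all }\omega\in[-\infty,\infty]\text{ and all }\tau\in(0,1],$$ then $P\#C$ is stable. -/

import Mathlib

/-! ### Real-rational transfer matrices -/

/-- The transfer function `g` is proper: the degree of its numerator does not exceed that of its
denominator. -/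
def IsProperRat (g : RatFunc ℝ) : Prop :=
  g.num.natDegree ≤ g.denom.natDegree

/-- The order of `s` as a pole of `g` (zero if `s` is not a pole): the multiplicity of `s` as a
root of the denominator of `g` in lowest terms. -/
noncomputable def poleOrder (g : RatFunc ℝ) (s : ℂ) : ℕ :=
  (g.denom.map (algebraMap ℝ ℂ)).rootMultiplicity s

/-- `s` is a pole of the transfer matrix `G` if it is a pole of some entry of `G`. -/
def IsPole {ι : Type*} (G : Matrix ι ι (RatFunc ℝ)) (s : ℂ) : Prop :=
  ∃ i j, poleOrder (G i j) s ≠ 0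

/-- The multiplicity of `s` as a pole of the transfer matrix `G` in the sense of McMillan: the
largest order of `s` as a pole of a minor of `G`. (Repeated rows or columns give a zero minor,
which has no poles.) -/
noncomputable def poleMultiplicity {ι : Type*} [Fintype ι] (G : Matrix ι ι (RatFunc ℝ)) (s : ℂ) :
    ℕ :=
  Finset.univ.sup fun k : Fin (Fintype.card ι + 1) =>
    Finset.univ.sup fun r : Fin k → ι => Finset.univ.sup fun c : Fin k → ι =>
      poleOrder (G.submatrix r c).det s

theorem poleOrder_support_finite (g : RatFunc ℝ) : {s : ℂ | poleOrder g s ≠ 0}.Finite := by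
  have h0 : g.denom.map (algebraMap ℝ ℂ) ≠ 0 :=
    (Polynomial.map_ne_zero_iff (algebraMap ℝ ℂ).injective).2 g.denom_ne_zero
  refine ((g.denom.map (algebraMap ℝ ℂ)).roots.toFinset.finite_toSet).subset fun s hs => ?_
  have hs' : (g.denom.map (algebraMap ℝ ℂ)).rootMultiplicity s ≠ 0 := hs
  simpa [h0, Polynomial.IsRoot] using
    (Polynomial.rootMultiplicity_pos h0).1 (Nat.pos_of_ne_zero hs')

/-- A transfer matrix has finitely many poles, so that the sum in `numPolesRHP` is a finite one. -/
theorem poleMultiplicity_support_finite {ι : Type*} [Fintype ι] (G : Matrix ι ι (RatFunc ℝ)) :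
    {s : ℂ | poleMultiplicity G s ≠ 0}.Finite := by
  have h : (⋃ k : Fin (Fintype.card ι + 1), ⋃ r : Fin k → ι, ⋃ c : Fin k → ι,
      {s : ℂ | poleOrder (G.submatrix r c).det s ≠ 0}).Finite :=
    Set.finite_iUnion fun k => Set.finite_iUnion fun r => Set.finite_iUnion fun c =>
      poleOrder_support_finite _
  refine h.subset fun s hs => ?_
  by_contra hn
  simp only [Set.mem_iUnion, Set.mem_ofPred_eq, not_exists, not_not] at hn
  refine hs (Nat.le_zero.1 (Finset.sup_le fun k _ => Finset.sup_le fun r _ =>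
    Finset.sup_le fun c _ => (hn k r c).le))

/-- The number of poles of `G` in the open right half-plane, counted with multiplicity. -/
noncomputable def numPolesRHP {ι : Type*} [Fintype ι] (G : Matrix ι ι (RatFunc ℝ)) : ℕ :=
  ∑ᶠ s ∈ {s : ℂ | 0 < s.re}, poleMultiplicity G s

/-- `G` is in `RL∞`: proper, without poles on the imaginary axis. -/
def IsRLInf {ι : Type*} (G : Matrix ι ι (RatFunc ℝ)) : Prop :=
  (∀ i j, IsProperRat (G i j)) ∧ ∀ s : ℂ, s.re = 0 → ¬ IsPole G s

/-- `G` is in `RH∞`: proper, without poles in the closed right half-plane. -/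
def IsRHInf {ι : Type*} (G : Matrix ι ι (RatFunc ℝ)) : Prop :=
  (∀ i j, IsProperRat (G i j)) ∧ ∀ s : ℂ, 0 ≤ s.re → ¬ IsPole G s

/-- `G` is `p`-dominant: it is in `RL∞` and has `p` poles in the open right half-plane. -/
def IsDominant {ι : Type*} [Fintype ι] (G : Matrix ι ι (RatFunc ℝ)) (p : ℕ) : Prop :=
  IsRLInf G ∧ numPolesRHP G = p

/-! ### Values on the extended imaginary axis -/

/-- The value at infinity of a proper transfer function: the coefficient of the numerator at the
degree of the denominator, divided by the leading coefficient of the denominator. -/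
noncomputable def valueAtInfinity (g : RatFunc ℝ) : ℝ :=
  g.num.coeff g.denom.natDegree / g.denom.leadingCoeff

/-- The frequency response `G(jω)` for `ω ∈ [-∞, ∞]`, where `G(±j∞) = G(∞)`. -/
noncomputable def freqResponse {ι : Type*} (G : Matrix ι ι (RatFunc ℝ)) : EReal → Matrix ι ι ℂ
  | ⊥ => G.map fun g => (valueAtInfinity g : ℂ)
  | ⊤ => G.map fun g => (valueAtInfinity g : ℂ)
  | (w : ℝ) => G.map fun g => g.eval (algebraMap ℝ ℂ) (Complex.I * w)

/-! ### The positive feedback system `P # C` -/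

/-- `P # C` is well-posed: `I - P(∞) C(∞)` has full rank. -/
def IsWellPosed {m : ℕ} (P C : Matrix (Fin m) (Fin m) (RatFunc ℝ)) : Prop :=
  (1 - P.map valueAtInfinity * C.map valueAtInfinity).rank = m

/-- The closed-loop transfer matrix from `(w₁, w₂)` to `(u₁, u₂)`, where `u₁ = w₁ + C u₂` and
`u₂ = w₂ + P u₁`. (Well-posedness makes the block matrix invertible.) -/
noncomputable def closedLoop {m : ℕ} (P C : Matrix (Fin m) (Fin m) (RatFunc ℝ)) :
    Matrix (Fin m ⊕ Fin m) (Fin m ⊕ Fin m) (RatFunc ℝ) :=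
  (Matrix.fromBlocks 1 (-C) (-P) 1)⁻¹

/-- `P # C` is `p`-dominant: it is well-posed and its closed-loop transfer matrix is in `RL∞` and
`p`-dominant. -/
def FeedbackDominant {m : ℕ} (P C : Matrix (Fin m) (Fin m) (RatFunc ℝ)) (p : ℕ) : Prop :=
  IsWellPosed P C ∧ IsDominant (closedLoop P C) p

/-- `P # C` is stable: it is `0`-dominant. -/
def FeedbackStable {m : ℕ} (P C : Matrix (Fin m) (Fin m) (RatFunc ℝ)) : Prop :=
  FeedbackDominant P C 0

/-! ### Scaled graphs of matrices -/

/-- The gain from `x` to `y` (used for `x ≠ 0` only). -/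
noncomputable def gain {m : ℕ} (x y : EuclideanSpace ℂ (Fin m)) : ℝ :=
  ‖y‖ / ‖x‖

/-- The phase from `x` to `y` (used for `x ≠ 0` and `y ≠ 0` only). -/
noncomputable def phase {m : ℕ} (x y : EuclideanSpace ℂ (Fin m)) : ℝ :=
  Real.arccos ((inner ℂ x y).re / (‖x‖ * ‖y‖))

/-- The scaled graph of `A`. All its points are finite, as `x` and `A x` are nonzero. -/
noncomputable def scaledGraph {m : ℕ} (A : Matrix (Fin m) (Fin m) ℂ) : Set ℂ :=
  {z | ∃ x y : EuclideanSpace ℂ (Fin m), x ≠ 0 ∧ y = Matrix.toEuclideanLin A x ∧ y ≠ 0 ∧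
    (z = gain x y * Complex.exp (Complex.I * phase x y) ∨
      z = gain x y * Complex.exp (-(Complex.I * phase x y)))}

/-- The inverse scaled graph of `A`, where input and output change places. -/
noncomputable def invScaledGraph {m : ℕ} (A : Matrix (Fin m) (Fin m) ℂ) : Set ℂ :=
  {z | ∃ x y : EuclideanSpace ℂ (Fin m), x ≠ 0 ∧ y = Matrix.toEuclideanLin A x ∧ y ≠ 0 ∧
    (z = gain y x * Complex.exp (Complex.I * phase y x) ∨
      z = gain y x * Complex.exp (-(Complex.I * phase y x)))}

/-!
The idea is to continue the return difference `det (1 - τ P C)` from `τ = 0` to `τ = 1` and to see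
that it never acquires a zero in the closed right half-plane or at infinity.

If `τ A B x = x` for some `x ≠ 0`, then with `y = B x` the gain and the phase from `y` to `x` give a
point of the scaled graph of `τ A` and of the inverse scaled graph of `B` at once. Separation of the
scaled graphs therefore makes `det (1 - τ P C)` nonzero on the extended imaginary axis for all
`τ ∈ (0, 1]` (`det_one_sub_smul_mul_ne_zero`), and for `τ = 0` it equals `1`.

The coordinate `u = 1 / (s + 1)` turns the closed right half-plane together with `∞` into the closed
disc with centre and radius `1 / 2`, on which stable transfer functions are continuous, and
holomorphic inside (`discEval`). No root counting is needed to bring the zero-freeness from the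
circle to the disc: by compactness `|det|` is at least some `ε > 0` on the circle, uniformly in `τ`,
and wherever the determinant has no zero in the disc the maximum principle for its inverse extends
the bound `ε` to the disc. So the set of `τ` without zeros is closed in `[0, 1]`; its complement is
closed by compactness, and `[0, 1]` is connected (`forall_ne_zero_of_homotopy`).

At `τ = 1` the point `u = 0` gives well-posedness. Moreover `det (1 - P C)`, which is the
determinant of the block matrix of the loop, is a unit of the ring `stableRat` of stable transfer
functions (`isUnit_of_discEval_ne_zero`). Hence the closed loop has entries in that ring, and so do
its minors, which leaves no poles to count.
-/

/-! ### Continuation of zero-freeness from a circle to its disc -/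

open Filter Topology Metric in
/-- If a family of functions on a closed disc, holomorphic inside, has no zero on the bounding
circle for any value of the parameter and no zero in the disc at the start, then it never has a zero
in the disc. -/
theorem forall_ne_zero_of_homotopy {f : ℝ → ℂ → ℂ} {c : ℂ} {r : ℝ} (hr : 0 < r)
    (hcont : ContinuousOn (Function.uncurry f) (Set.Icc 0 1 ×ˢ closedBall c r))
    (hdiff : ∀ τ ∈ Set.Icc (0 : ℝ) 1, DifferentiableOn ℂ (f τ) (ball c r))
    (hsphere : ∀ τ ∈ Set.Icc (0 : ℝ) 1, ∀ u ∈ sphere c r, f τ u ≠ 0)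
    (hzero : ∀ u ∈ closedBall c r, f 0 u ≠ 0) :
    ∀ τ ∈ Set.Icc (0 : ℝ) 1, ∀ u ∈ closedBall c r, f τ u ≠ 0 := by
  have hcontτ : ∀ τ ∈ Set.Icc (0 : ℝ) 1, ContinuousOn (f τ) (closedBall c r) := fun τ hτ =>
    hcont.comp (f := fun u => (τ, u)) (by fun_prop) fun u hu => ⟨hτ, hu⟩
  have hcontu : ∀ u ∈ closedBall c r, ContinuousOn (fun τ => f τ u) (Set.Icc 0 1) := fun u hu =>
    hcont.comp (f := fun τ => (τ, u)) (by fun_prop) fun τ hτ => ⟨hτ, hu⟩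
  obtain ⟨ε, hε, hεle⟩ : ∃ ε > 0, ∀ τ ∈ Set.Icc (0 : ℝ) 1, ∀ u ∈ sphere c r, ε ≤ ‖f τ u‖ := by
    obtain ⟨p, hp, hmin⟩ := (isCompact_Icc.prod (isCompact_sphere c r)).exists_isMinOn
      (Set.Nonempty.prod ⟨(0 : ℝ), by simp⟩ (NormedSpace.sphere_nonempty.2 hr.le))
      (hcont.norm.mono (Set.prod_mono_right sphere_subset_closedBall))
    exact ⟨‖f p.1 p.2‖, norm_pos_iff.2 (hsphere _ hp.1 _ hp.2), fun τ hτ u hu =>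
      isMinOn_iff.1 hmin (τ, u) ⟨hτ, hu⟩⟩
  -- Where `f τ` has no zero, the maximum principle for `1 / f τ` extends the bound to the disc.
  have hbound : ∀ τ ∈ Set.Icc (0 : ℝ) 1, (∀ u ∈ closedBall c r, f τ u ≠ 0) →
      ∀ u ∈ closedBall c r, ε ≤ ‖f τ u‖ := by
    intro τ hτ hne u hu
    have hd : DiffContOnCl ℂ (fun u => (f τ u)⁻¹) (ball c r) := by
      refine ⟨(hdiff τ hτ).inv fun x hx => hne x (ball_subset_closedBall hx), ?_⟩
      rw [closure_ball c hr.ne']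
      exact (hcontτ τ hτ).inv₀ hne
    have h := Complex.norm_le_of_forall_mem_frontier_norm_le isBounded_ball hd (C := ε⁻¹)
      (fun z hz => ?_) (z := u) (by rwa [closure_ball c hr.ne'])
    · rw [norm_inv] at h
      exact (inv_le_inv₀ (norm_pos_iff.2 (hne u hu)) hε).1 h
    · rw [frontier_ball c hr.ne'] at hz
      rw [norm_inv]
      exact inv_anti₀ hε (hεle τ hτ z hz)
  -- The parameters whose function has a zero and those without one both form closed sets.
  have hbad : IsClosed (Prod.fst '' ((Set.Icc (0 : ℝ) 1 ×ˢ closedBall c r) ∩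
      Function.uncurry f ⁻¹' {0})) := by
    have hK := isCompact_Icc.prod (isCompact_closedBall c r) (s := Set.Icc (0 : ℝ) 1)
    exact ((hK.of_isClosed_subset (hcont.preimage_isClosed_of_isClosed hK.isClosed
      isClosed_singleton) Set.inter_subset_left).image continuous_fst).isClosed
  have hgood : IsClosed {τ ∈ Set.Icc (0 : ℝ) 1 | ∀ u ∈ closedBall c r, ε ≤ ‖f τ u‖} := by
    have : {τ ∈ Set.Icc (0 : ℝ) 1 | ∀ u ∈ closedBall c r, ε ≤ ‖f τ u‖} =
        Set.Icc 0 1 ∩ ⋂ u ∈ closedBall c r, Set.Icc 0 1 ∩ (fun τ => ‖f τ u‖) ⁻¹' Set.Ici ε := by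
      ext τ
      simp only [Set.mem_ofPred_eq, Set.mem_inter_iff, Set.mem_iInter, Set.mem_preimage,
        Set.mem_Ici]
      exact ⟨fun h => ⟨h.1, fun u hu => ⟨h.1, h.2 u hu⟩⟩, fun h => ⟨h.1, fun u hu => (h.2 u hu).2⟩⟩
    rw [this]
    exact isClosed_Icc.inter (isClosed_biInter fun u hu =>
      (hcontu u hu).norm.preimage_isClosed_of_isClosed isClosed_Icc isClosed_Ici)
  have hcover : Set.Icc (0 : ℝ) 1 ⊆ Prod.fst '' ((Set.Icc (0 : ℝ) 1 ×ˢ closedBall c r) ∩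
      Function.uncurry f ⁻¹' {0}) ∪
      {τ ∈ Set.Icc (0 : ℝ) 1 | ∀ u ∈ closedBall c r, ε ≤ ‖f τ u‖} := by
    intro σ hσ
    by_cases h : ∀ v ∈ closedBall c r, f σ v ≠ 0
    · exact Or.inr ⟨hσ, hbound σ hσ h⟩
    · push Not at h
      obtain ⟨v, hv, hv0⟩ := h
      exact Or.inl ⟨(σ, v), ⟨⟨hσ, hv⟩, hv0⟩, rfl⟩
  intro τ hτ u hu hfu
  obtain ⟨_, -, ⟨⟨σ, v⟩, ⟨⟨-, hv⟩, hv0⟩, rfl⟩, hσ⟩ := isPreconnected_closed_iff.1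
    isPreconnected_Icc _ _ hbad hgood hcover ⟨τ, hτ, (τ, u), ⟨⟨hτ, hu⟩, hfu⟩, rfl⟩
    ⟨0, by simp, by simp, hbound 0 (by simp) hzero⟩
  have h0 : f σ v = 0 := hv0
  have h1 := hσ.2 v hv
  rw [h0, norm_zero] at h1
  exact hε.not_ge h1

/-! ### The ring of stable transfer functions -/

theorem poleOrder_eq_zero_iff {g : RatFunc ℝ} {s : ℂ} :
    poleOrder g s = 0 ↔ g.denom.eval₂ (algebraMap ℝ ℂ) s ≠ 0 := by
  have h0 : g.denom.map (algebraMap ℝ ℂ) ≠ 0 :=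
    (Polynomial.map_ne_zero_iff (algebraMap ℝ ℂ).injective).2 g.denom_ne_zero
  rw [poleOrder, Polynomial.rootMultiplicity_eq_zero_iff, Polynomial.IsRoot,
    Polynomial.eval_map]
  simp [h0]

theorem isProperRat_iff {g : RatFunc ℝ} : IsProperRat g ↔ g.intDegree ≤ 0 := by
  rw [IsProperRat, RatFunc.intDegree]
  omega

theorem IsProperRat.add {g h : RatFunc ℝ} (hg : IsProperRat g) (hh : IsProperRat h) :
    IsProperRat (g + h) := by
  rw [isProperRat_iff] at *
  by_cases h0 : h = 0
  · simpa [h0] using hg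
  by_cases h1 : g + h = 0
  · simp [h1]
  exact (RatFunc.intDegree_add_le h0 h1).trans (max_le hg hh)

theorem IsProperRat.mul {g h : RatFunc ℝ} (hg : IsProperRat g) (hh : IsProperRat h) :
    IsProperRat (g * h) := by
  rw [isProperRat_iff] at *
  by_cases h0 : h = 0
  · simp [h0]
  by_cases h1 : g = 0
  · simp [h1]
  rw [RatFunc.intDegree_mul h1 h0]
  omega

theorem denom_eval₂_ne_zero_of_dvd {g : RatFunc ℝ} {q : Polynomial ℝ} {s : ℂ} (h : g.denom ∣ q)
    (hq : q.eval₂ (algebraMap ℝ ℂ) s ≠ 0) : g.denom.eval₂ (algebraMap ℝ ℂ) s ≠ 0 := fun h0 =>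
  hq (Polynomial.eval₂_eq_zero_of_dvd_of_eval₂_eq_zero _ _ h h0)

/-- The ring of scalar stable transfer functions: the proper real-rational functions without poles
in the closed right half-plane. -/
noncomputable def stableRat : Subring (RatFunc ℝ) where
  carrier := {g | IsProperRat g ∧ ∀ s : ℂ, 0 ≤ s.re → g.denom.eval₂ (algebraMap ℝ ℂ) s ≠ 0}
  zero_mem' := by simp [IsProperRat]
  one_mem' := by simp [IsProperRat]
  add_mem' := fun ha hb => ⟨ha.1.add hb.1, fun s hs =>
    denom_eval₂_ne_zero_of_dvd (RatFunc.denom_add_dvd _ _)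
      (by rw [Polynomial.eval₂_mul]; exact mul_ne_zero (ha.2 s hs) (hb.2 s hs))⟩
  mul_mem' := fun ha hb => ⟨ha.1.mul hb.1, fun s hs =>
    denom_eval₂_ne_zero_of_dvd (RatFunc.denom_mul_dvd _ _)
      (by rw [Polynomial.eval₂_mul]; exact mul_ne_zero (ha.2 s hs) (hb.2 s hs))⟩
  neg_mem' := fun {a} ha => by
    refine ⟨?_, fun s hs => denom_eval₂_ne_zero_of_dvd ?_ (ha.2 s hs)⟩
    · rw [isProperRat_iff, RatFunc.intDegree_neg, ← isProperRat_iff]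
      exact ha.1
    · refine (RatFunc.denom_dvd a.denom_ne_zero).2 ⟨-a.num, ?_⟩
      rw [map_neg, neg_div, RatFunc.num_div_denom]

theorem isRHInf_iff {ι : Type*} {G : Matrix ι ι (RatFunc ℝ)} :
    IsRHInf G ↔ ∀ i j, G i j ∈ stableRat := by
  constructor
  · intro h i j
    refine ⟨h.1 i j, fun s hs => poleOrder_eq_zero_iff.1 ?_⟩
    by_contra h0
    exact h.2 s hs ⟨i, j, h0⟩
  · intro h
    refine ⟨fun i j => (h i j).1, ?_⟩
    rintro s hs ⟨i, j, h0⟩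
    exact h0 (poleOrder_eq_zero_iff.2 ((h i j).2 s hs))

/-! ### Evaluation on the compactified right half-plane -/

open Filter Topology in
theorem IsProperRat.tendsto_eval {g : RatFunc ℝ} (hg : IsProperRat g) :
    Tendsto (fun s => g.eval (algebraMap ℝ ℂ) s) (Bornology.cobounded ℂ)
      (𝓝 (valueAtInfinity g : ℂ)) := by
  set n := g.denom.natDegree
  -- In the variable `1 / s` both polynomials are replaced by their reflections.
  have key : ∀ p : Polynomial ℝ, p.natDegree ≤ n → ∀ s : ℂ, s ≠ 0 →
      (p.reflect n).eval₂ (algebraMap ℝ ℂ) s⁻¹ * s ^ n = p.eval₂ (algebraMap ℝ ℂ) s := by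
    intro p hp s hs
    let := invertibleOfNonzero hs
    simpa using Polynomial.eval₂_reflect_mul_pow (algebraMap ℝ ℂ) s n p hp
  have hlim : ∀ p : Polynomial ℝ, Tendsto (fun s : ℂ => (p.reflect n).eval₂ (algebraMap ℝ ℂ) s⁻¹)
      (Bornology.cobounded ℂ) (𝓝 (p.coeff n : ℂ)) := by
    intro p
    have h0 : (p.reflect n).eval₂ (algebraMap ℝ ℂ) 0 = (p.coeff n : ℂ) := by
      simp [Polynomial.eval₂_at_zero, Polynomial.coeff_reflect, Polynomial.revAt_le]
    rw [← h0]
    have hc : Continuous fun x : ℂ => (p.reflect n).eval₂ (algebraMap ℝ ℂ) x :=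
      Polynomial.continuous_eval₂ _ _
    exact (hc.tendsto 0).comp tendsto_inv₀_cobounded
  have hlead : (g.denom.coeff n : ℂ) ≠ 0 := by
    simpa [n] using g.denom_ne_zero
  have hdiv := (hlim g.num).div (hlim g.denom) hlead
  have hval : (valueAtInfinity g : ℂ) = (g.num.coeff n : ℂ) / (g.denom.coeff n : ℂ) := by
    simp [valueAtInfinity, n]
  rw [hval]
  refine hdiv.congr' ?_
  filter_upwards [Bornology.eventually_ne_cobounded 0] with s hs
  rw [RatFunc.eval, ← key _ hg s hs, ← key _ le_rfl s hs, Pi.div_apply,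
    mul_div_mul_right _ _ (pow_ne_zero n hs)]

/-- The value of `g` at the point `s = 1 / u - 1` of the Riemann sphere, where `u = 0` stands for
`s = ∞`. In the coordinate `u = 1 / (s + 1)` the closed right half-plane together with `∞` is the
closed disc with centre and radius `1 / 2`. -/
noncomputable def discEval (u : ℂ) (g : RatFunc ℝ) : ℂ :=
  if u = 0 then (valueAtInfinity g : ℂ) else g.eval (algebraMap ℝ ℂ) (u⁻¹ - 1)

theorem discEval_zero_left (g : RatFunc ℝ) : discEval 0 g = valueAtInfinity g := if_pos rfl

theorem discEval_of_ne_zero {u : ℂ} (hu : u ≠ 0) (g : RatFunc ℝ) :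
    discEval u g = g.eval (algebraMap ℝ ℂ) (u⁻¹ - 1) := if_neg hu

theorem re_inv_sub_one {u : ℂ} (hu : u ≠ 0) :
    (u⁻¹ - 1).re = ((1 / 2) ^ 2 - dist u (1 / 2) ^ 2) / Complex.normSq u := by
  have h : Complex.normSq u ≠ 0 := Complex.normSq_eq_zero.not.2 hu
  rw [dist_eq_norm, ← Complex.normSq_eq_norm_sq, Complex.sub_re, Complex.inv_re, Complex.one_re]
  field_simp
  rw [Complex.normSq_apply, Complex.normSq_apply]
  norm_num
  ring

theorem re_nonneg_of_mem_closedBall {u : ℂ} (hu : u ≠ 0)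
    (h : u ∈ Metric.closedBall (1 / 2 : ℂ) (1 / 2)) : 0 ≤ (u⁻¹ - 1).re := by
  rw [re_inv_sub_one hu]
  exact div_nonneg (sub_nonneg.2 (pow_le_pow_left₀ dist_nonneg (Metric.mem_closedBall.1 h) 2))
    (Complex.normSq_nonneg u)

theorem re_eq_zero_of_mem_sphere {u : ℂ} (hu : u ≠ 0)
    (h : u ∈ Metric.sphere (1 / 2 : ℂ) (1 / 2)) : (u⁻¹ - 1).re = 0 := by
  rw [re_inv_sub_one hu, Metric.mem_sphere.1 h, sub_self, zero_div]

theorem inv_add_one_mem_closedBall {s : ℂ} (hs : 0 ≤ s.re) :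
    (s + 1)⁻¹ ≠ 0 ∧ (s + 1)⁻¹ ∈ Metric.closedBall (1 / 2 : ℂ) (1 / 2) := by
  have h1 : s + 1 ≠ 0 := fun h => by
    have := congrArg Complex.re h
    simp at this
    linarith
  have h2 := inv_ne_zero h1
  refine ⟨h2, Metric.mem_closedBall.2 ?_⟩
  have h3 := re_inv_sub_one h2
  rw [inv_inv, add_sub_cancel_right] at h3
  rw [h3, le_div_iff₀ (Complex.normSq_pos.2 h2), zero_mul, sub_nonneg] at hs
  exact (pow_le_pow_iff_left₀ dist_nonneg (by norm_num) two_ne_zero).1 hs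

open Filter Topology in
theorem IsProperRat.continuousAt_discEval_zero {g : RatFunc ℝ} (hg : IsProperRat g) :
    ContinuousAt (fun u => discEval u g) 0 := by
  rw [continuousAt_iff_punctured_nhds, discEval_zero_left]
  have h : Tendsto (fun u : ℂ => u⁻¹ - 1) (𝓝[≠] 0) (Bornology.cobounded ℂ) :=
    (tendsto_sub_const_cobounded 1).comp tendsto_inv₀_nhdsNE_zero
  refine (hg.tendsto_eval.comp h).congr' ?_
  filter_upwards [self_mem_nhdsWithin] with u hu
  exact (discEval_of_ne_zero hu g).symm

open Filter Topology in
theorem differentiableAt_discEval {g : RatFunc ℝ} (hg : g ∈ stableRat) {u : ℂ} (hu : u ≠ 0)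
    (hmem : u ∈ Metric.closedBall (1 / 2 : ℂ) (1 / 2)) :
    DifferentiableAt ℂ (fun u => discEval u g) u := by
  have hpoly : ∀ p : Polynomial ℝ,
      DifferentiableAt ℂ (fun u : ℂ => p.eval₂ (algebraMap ℝ ℂ) (u⁻¹ - 1)) u := by
    intro p
    simp_rw [← Polynomial.eval_map]
    exact (Polynomial.differentiable _).differentiableAt.comp u
      ((differentiableAt_inv hu).sub_const 1)
  refine ((hpoly g.num).div (hpoly g.denom)
    (hg.2 _ (re_nonneg_of_mem_closedBall hu hmem))).congr_of_eventuallyEq ?_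
  filter_upwards [isOpen_ne.mem_nhds hu] with v hv
  exact discEval_of_ne_zero hv g

theorem continuousOn_discEval {g : RatFunc ℝ} (hg : g ∈ stableRat) :
    ContinuousOn (fun u => discEval u g) (Metric.closedBall (1 / 2) (1 / 2)) := by
  intro u hmem
  refine ContinuousAt.continuousWithinAt ?_
  by_cases hu : u = 0
  · rw [hu]
    exact hg.1.continuousAt_discEval_zero
  · exact (differentiableAt_discEval hg hu hmem).continuousAt

theorem differentiableOn_discEval {g : RatFunc ℝ} (hg : g ∈ stableRat) :
    DifferentiableOn ℂ (fun u => discEval u g) (Metric.ball (1 / 2) (1 / 2)) := by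
  intro u hmem
  refine (differentiableAt_discEval hg ?_ (Metric.ball_subset_closedBall hmem)).differentiableWithinAt
  rintro rfl
  simp [Metric.mem_ball, dist_eq_norm] at hmem

/-- Evaluation at a point of the closed disc is a ring homomorphism. At `u = 0` this is seen by
passing to the limit `s → ∞`. -/
noncomputable def discEvalHom (u : ℂ) (hu : u ∈ Metric.closedBall (1 / 2 : ℂ) (1 / 2)) :
    stableRat →+* ℂ :=
  have hext {F G : ℂ → ℂ} (hF : ContinuousOn F (Metric.closedBall (1 / 2) (1 / 2)))
      (hG : ContinuousOn G (Metric.closedBall (1 / 2) (1 / 2)))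
      (h : ∀ v ∈ Metric.closedBall (1 / 2 : ℂ) (1 / 2), v ≠ 0 → F v = G v) : F u = G u := by
    have hsub : Metric.closedBall (1 / 2 : ℂ) (1 / 2) ⊆ closure (Metric.ball (1 / 2) (1 / 2)) := by
      rw [closure_ball _ (by norm_num)]
    refine Set.EqOn.of_subset_closure (fun v hv => ?_) hF hG Metric.ball_subset_closedBall hsub hu
    refine h v (Metric.ball_subset_closedBall hv) ?_
    rintro rfl
    simp [Metric.mem_ball, dist_eq_norm] at hv
  { toFun := fun g => discEval u g
    map_one' := by simp [discEval, valueAtInfinity]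
    map_zero' := by simp [discEval, valueAtInfinity]
    map_add' := fun g h => hext (continuousOn_discEval (g + h).2)
      ((continuousOn_discEval g.2).add (continuousOn_discEval h.2)) fun v hv hv0 => by
        have hre := re_nonneg_of_mem_closedBall hv0 hv
        simp only [Pi.add_apply, discEval_of_ne_zero hv0, Subring.coe_add]
        exact RatFunc.eval_add _ _ (g.2.2 _ hre) (h.2.2 _ hre)
    map_mul' := fun g h => hext (continuousOn_discEval (g * h).2)
      ((continuousOn_discEval g.2).mul (continuousOn_discEval h.2)) fun v hv hv0 => by
        have hre := re_nonneg_of_mem_closedBall hv0 hv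
        simp only [Pi.mul_apply, discEval_of_ne_zero hv0, Subring.coe_mul]
        exact RatFunc.eval_mul _ _ (g.2.2 _ hre) (h.2.2 _ hre) }

theorem discEvalHom_apply (u : ℂ) (hu : u ∈ Metric.closedBall (1 / 2 : ℂ) (1 / 2))
    (g : stableRat) : discEvalHom u hu g = discEval u g := rfl

/-- A stable transfer function without zeros in the closed right half-plane or at infinity has a
stable inverse; the value at infinity being nonzero is what makes the inverse proper. -/
theorem isUnit_of_discEval_ne_zero {g : stableRat}
    (h : ∀ u ∈ Metric.closedBall (1 / 2 : ℂ) (1 / 2), discEval u g ≠ 0) : IsUnit g := by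
  have hval : valueAtInfinity (g : RatFunc ℝ) ≠ 0 := by
    simpa [discEval_zero_left] using h 0 (by simp [dist_eq_norm])
  have hg0 : (g : RatFunc ℝ) ≠ 0 := by
    intro h0
    simp [h0, valueAtInfinity] at hval
  have hmem : (g : RatFunc ℝ)⁻¹ ∈ stableRat := by
    refine ⟨?_, fun s hs => ?_⟩
    · rw [isProperRat_iff, RatFunc.intDegree_inv, neg_nonpos, RatFunc.intDegree, sub_nonneg,
        Nat.cast_le]
      refine Polynomial.le_natDegree_of_ne_zero fun h0 => hval ?_
      rw [valueAtInfinity, h0, zero_div]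
    · refine denom_eval₂_ne_zero_of_dvd (RatFunc.denom_inv_dvd hg0) fun h0 => ?_
      obtain ⟨hne, hball⟩ := inv_add_one_mem_closedBall hs
      refine h _ hball ?_
      rw [discEval_of_ne_zero hne, inv_inv, add_sub_cancel_right, RatFunc.eval, h0, zero_div]
  exact IsUnit.of_mul_eq_one ⟨_, hmem⟩ (Subtype.ext (mul_inv_cancel₀ hg0))

/-! ### The return difference -/

/-- A fixed vector of `τ A B` would yield a common point of the two scaled graphs. -/
theorem det_one_sub_smul_mul_ne_zero {m : ℕ} {A B : Matrix (Fin m) (Fin m) ℂ} {τ : ℂ}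
    (h : scaledGraph (τ • A) ∩ invScaledGraph B = ∅) : (1 - τ • (A * B)).det ≠ 0 := by
  intro hdet
  obtain ⟨v, hv, hv0⟩ := Matrix.exists_mulVec_eq_zero_iff.2 hdet
  rw [Matrix.sub_mulVec, Matrix.one_mulVec, sub_eq_zero, ← smul_mul_assoc,
    ← Matrix.mulVec_mulVec] at hv0
  set x : EuclideanSpace ℂ (Fin m) := WithLp.toLp 2 v with hx
  set y : EuclideanSpace ℂ (Fin m) := Matrix.toEuclideanLin B x with hy
  have hxy : x = Matrix.toEuclideanLin (τ • A) y := by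
    rw [hy, hx, Matrix.toLpLin_toLp, Matrix.toLpLin_toLp]
    exact congrArg (WithLp.toLp 2) hv0
  have hx0 : x ≠ 0 := fun h0 => hv (by simpa [hx] using h0)
  have hy0 : y ≠ 0 := by
    intro h0
    rw [h0, map_zero] at hxy
    exact hx0 hxy
  refine (Set.eq_empty_iff_forall_notMem.1 h) (gain y x * Complex.exp (Complex.I * phase y x))
    ⟨⟨y, x, hy0, hxy, hx0, Or.inl rfl⟩, ⟨x, y, hx0, hy, hy0, Or.inl rfl⟩⟩

/-- The bounding circle is the extended imaginary axis. -/
theorem exists_freqResponse_eq_discEval {ι : Type*} {u : ℂ}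
    (hu : u ∈ Metric.sphere (1 / 2 : ℂ) (1 / 2)) :
    ∃ ω : EReal, ∀ G : Matrix ι ι (RatFunc ℝ), freqResponse G ω = G.map (discEval u) := by
  by_cases h0 : u = 0
  · refine ⟨⊤, fun G => ?_⟩
    rw [h0, funext discEval_zero_left]
    rfl
  · refine ⟨((u⁻¹ - 1).im : ℝ), fun G => ?_⟩
    have hs : Complex.I * ((u⁻¹ - 1).im : ℝ) = u⁻¹ - 1 := by
      apply Complex.ext
      · rw [re_eq_zero_of_mem_sphere h0 hu]
        simp
      · simp
    rw [funext (discEval_of_ne_zero h0)]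
    nth_rw 2 [← hs]
    rfl

open Metric in
theorem det_one_sub_map_discEval_ne_zero {m : ℕ} {P C : Matrix (Fin m) (Fin m) (RatFunc ℝ)}
    (hP : IsRHInf P) (hC : IsRHInf C)
    (hsep : ∀ ω : EReal, ∀ τ : ℝ, τ ∈ Set.Ioc (0 : ℝ) 1 →
      scaledGraph ((τ : ℂ) • freqResponse P ω) ∩ invScaledGraph (freqResponse C ω) = ∅)
    {u : ℂ} (hu : u ∈ closedBall (1 / 2 : ℂ) (1 / 2)) :
    (1 - P.map (discEval u) * C.map (discEval u)).det ≠ 0 := by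
  rw [isRHInf_iff] at hP hC
  have hentry : ∀ (τ : ℝ) (v : ℂ) (i j : Fin m),
      (1 - (τ : ℂ) • (P.map (discEval v) * C.map (discEval v))) i j =
        (1 : Matrix (Fin m) (Fin m) ℂ) i j - τ * ∑ k, discEval v (P i k) * discEval v (C k j) :=
    fun τ v i j => by simp [Matrix.mul_apply]
  have key := forall_ne_zero_of_homotopy (c := 1 / 2) (r := 1 / 2)
    (f := fun τ v => (1 - (τ : ℂ) • (P.map (discEval v) * C.map (discEval v))).det) (by norm_num)
    ?_ ?_ ?_ (by simp) 1 (by simp) u hu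
  · simpa using key
  · simp only [Function.uncurry_def, Matrix.det_apply', hentry]
    have h : ∀ g ∈ stableRat, ContinuousOn (fun p : ℝ × ℂ => discEval p.2 g)
        (Set.Icc 0 1 ×ˢ closedBall (1 / 2) (1 / 2)) := fun g hg =>
      (continuousOn_discEval hg).comp continuousOn_snd fun p hp => hp.2
    refine continuousOn_finsetSum _ fun σ _ => continuousOn_const.mul
      (continuousOn_finsetProd _ fun i _ => continuousOn_const.sub
      (ContinuousOn.mul (by fun_prop)
        (continuousOn_finsetSum _ fun k _ => (h _ (hP _ _)).mul (h _ (hC _ _)))))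
  · intro τ _
    simp only [Matrix.det_apply', hentry]
    refine DifferentiableOn.fun_sum fun σ _ => (differentiableOn_const _).mul
      (DifferentiableOn.fun_finsetProd fun i _ => (differentiableOn_const _).sub
      ((differentiableOn_const _).mul (DifferentiableOn.fun_sum fun k _ =>
        (differentiableOn_discEval (hP _ _)).mul (differentiableOn_discEval (hC _ _)))))
  · intro τ hτ v hv
    obtain rfl | hτ0 := hτ.1.eq_or_lt
    · simp
    obtain ⟨ω, hω⟩ := exists_freqResponse_eq_discEval (ι := Fin m) hv
    have := det_one_sub_smul_mul_ne_zero (hsep ω τ ⟨hτ0, hτ.2⟩)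
    rwa [hω P, hω C] at this

/-! ### The closed loop -/

theorem isDominant_zero_of_isRHInf {ι : Type*} [Fintype ι] {G : Matrix ι ι (RatFunc ℝ)}
    (hG : IsRHInf G) : IsDominant G 0 := by
  refine ⟨⟨hG.1, fun s hs => hG.2 s hs.ge⟩, finsum_mem_eq_zero_of_forall_eq_zero fun s hs => ?_⟩
  refine Nat.le_zero.1 (Finset.sup_le fun k _ => Finset.sup_le fun r _ =>
    Finset.sup_le fun c _ => (poleOrder_eq_zero_iff.2 ?_).le)
  have hmem : (G.submatrix r c).det ∈ stableRat := by
    rw [Matrix.det_apply]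
    exact sum_mem fun σ _ => Subring.zsmul_mem _ (prod_mem fun i _ => isRHInf_iff.1 hG _ _) _
  exact hmem.2 s (le_of_lt hs)

theorem isRHInf_closedLoop {m : ℕ} {P C : Matrix (Fin m) (Fin m) (RatFunc ℝ)}
    (hP : IsRHInf P) (hC : IsRHInf C)
    (h : ∀ u ∈ Metric.closedBall (1 / 2 : ℂ) (1 / 2),
      (1 - P.map (discEval u) * C.map (discEval u)).det ≠ 0) : IsRHInf (closedLoop P C) := by
  rw [isRHInf_iff] at hP hC
  set P' : Matrix (Fin m) (Fin m) stableRat := .of fun i j => ⟨P i j, hP i j⟩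
  set C' : Matrix (Fin m) (Fin m) stableRat := .of fun i j => ⟨C i j, hC i j⟩
  set M : Matrix (Fin m ⊕ Fin m) (Fin m ⊕ Fin m) stableRat := Matrix.fromBlocks 1 (-C') (-P') 1
  have hM : IsUnit M.det := by
    refine isUnit_of_discEval_ne_zero fun u hu => ?_
    rw [← discEvalHom_apply u hu, Matrix.det_fromBlocks_one₁₁, neg_mul_neg, RingHom.map_det,
      map_sub, map_one, map_mul]
    exact h u hu
  have hmap : stableRat.subtype.mapMatrix M = Matrix.fromBlocks 1 (-C) (-P) 1 := by
    rw [RingHom.mapMatrix_apply, Matrix.fromBlocks_map]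
    congr 1
    · exact map_one stableRat.subtype.mapMatrix
    · exact map_one stableRat.subtype.mapMatrix
  have hinv : closedLoop P C = stableRat.subtype.mapMatrix M⁻¹ := by
    refine Matrix.inv_eq_right_inv ?_
    rw [← hmap, ← map_mul, Matrix.mul_nonsing_inv _ hM, map_one]
  rw [isRHInf_iff, hinv]
  exact fun i j => (M⁻¹ i j).2

theorem isWellPosed_of_det_ne_zero {m : ℕ} {P C : Matrix (Fin m) (Fin m) (RatFunc ℝ)}
    (h : (1 - P.map (discEval 0) * C.map (discEval 0)).det ≠ 0) : IsWellPosed P C := by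
  have hmap : ∀ G : Matrix (Fin m) (Fin m) (RatFunc ℝ),
      G.map (discEval 0) = Complex.ofRealHom.mapMatrix (G.map valueAtInfinity) := fun G => by
    ext i j
    simp [discEval_zero_left]
  rw [hmap, hmap, ← map_mul, ← map_one Complex.ofRealHom.mapMatrix, ← map_sub,
    ← RingHom.map_det] at h
  have hdet := (map_ne_zero _).1 h
  rw [IsWellPosed, Matrix.rank_of_isUnit _ ((Matrix.isUnit_iff_isUnit_det _).2 hdet.isUnit),
    Fintype.card_fin]

theorem mainTheorem3 (m : ℕ) (P C : Matrix (Fin m) (Fin m) (RatFunc ℝ))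
    (hP : IsRHInf P) (hC : IsRHInf C)
    (hsep : ∀ ω : EReal, ∀ τ : ℝ, τ ∈ Set.Ioc (0 : ℝ) 1 →
      scaledGraph ((τ : ℂ) • freqResponse P ω) ∩ invScaledGraph (freqResponse C ω) = ∅) :
    FeedbackStable P C := by
  have h : ∀ u ∈ Metric.closedBall (1 / 2 : ℂ) (1 / 2),
      (1 - P.map (discEval u) * C.map (discEval u)).det ≠ 0 := fun u hu =>
    det_one_sub_map_discEval_ne_zero hP hC hsep hu
  exact ⟨isWellPosed_of_det_ne_zero (h 0 (by simp [dist_eq_norm])),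
    isDominant_zero_of_isRHInf (isRHInf_closedLoop hP hC h)⟩
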